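/- Let $1\le k\le n$ and $m=k$ be integers, and let $\mu_1,\mu_2>0$ and $0\le\epsilon<1$. Run-time. There are $n$ workers. Worker $i\in\{1,\dots,n\}$ has computation time $X_i$, exponentially distributed with rate $\frac{k}{m}\mu_1$, and communication time $$S_i=\sum_{r=1}^{m/k}\ \sum_{j=1}^{N_{i,r}}Y_{i,j,r},$$ where $N_{i,r}$ is geometric with $\Pr[N_{i,r}=l]=(1-\epsilon)\epsilon^{l-1}$ for $l\ge 1$, $Y_{i,j,r}$ is exponentially distributed with rate $\mu_2$, and all the variables $X_i$, $N_{i,r}$, $Y_{i,j,r}$ are mutually independent. (As $m=k$, there is exactly one index $r$, and $X_i$ has rate $\mu_1$.) The overall run-time $T$ is the $k$-th smallest of the $n$ numbers $X_i+S_i$, $1\le i\le n$. Markov chain. Let $\mathbb{C}$ be a right-continuous continuous-time Markov chain on the state space $\{0,1,\dots,n\}\times\{0,1,\dots,k\}$ which starts at $(0,0)$ and has the following transition rates: - from $(u,v)$ to $(u+1,v)$ the rate is $(n-u)\mu_1$ if $v\le u<n$; - from $(u,v)$ to $(u,v+1)$ the rate is $(u-v)(1-\epsilon)\mu_2$ if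 $0\le v<\min(u,k)$; - all other transition rates are $0$. Then $\mathbb{E}[T]$ is finite, and the expected hitting time by $\mathbb{C}$ of the set of states $(u,v)$ with $v=k$ equals $\mathbb{E}[T]$. -/

import Mathlib

open Set Filter Topology MeasureTheory ProbabilityTheory
open scoped NNReal ENNReal

/-! ### Continuous-time Markov chains on a finite state space -/

/-- A (homogeneous) transition function on the finite set `E`: stochastic matrices `P t`, `t ≥ 0`,
with `P 0 = 1` and the Chapman-Kolmogorov equations. -/
structure IsTransitionFunction {E : Type*} [Fintype E] [DecidableEq E]
    (P : ℝ≥0 → Matrix E E ℝ) : Prop where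
  nonneg : ∀ t x y, 0 ≤ P t x y
  row_sum : ∀ t x, ∑ y, P t x y = 1
  zero : P 0 = 1
  add : ∀ s t, P (s + t) = P s * P t

/-- `q x y`, for `x ≠ y`, is the transition rate from `x` to `y` of the transition function `P`:
`P h x y = q x y * h + o(h)` as `h` decreases to `0`. (The values `q x x` play no role.) -/
def HasTransitionRates {E : Type*} (P : ℝ≥0 → Matrix E E ℝ) (q : E → E → ℝ) : Prop :=
  ∀ x y, x ≠ y → Tendsto (fun h : ℝ≥0 => P h x y / (h : ℝ)) (𝓝[>] 0) (𝓝 (q x y))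

/-- `Z` is a continuous-time Markov chain on the finite set `E` with transition rates `q`, started
at `x₀`: a right-continuous process (for the discrete topology of `E`) whose finite-dimensional
distributions are those of the Markov process that starts at `x₀` and has a transition function
with rates `q`. -/
structure IsMarkovChainFrom {E Ω : Type*} [Fintype E] [DecidableEq E] [MeasurableSpace Ω]
    (q : E → E → ℝ) (x₀ : E) (Z : ℝ≥0 → Ω → E) (Pr : Measure Ω) : Prop where
  measurable : ∀ t x, MeasurableSet {ω | Z t ω = x}
  right_continuous : ∀ ω t, ∀ᶠ s in 𝓝[≥] t, Z s ω = Z t ω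
  markov : ∃ P : ℝ≥0 → Matrix E E ℝ, IsTransitionFunction P ∧ HasTransitionRates P q ∧
    ∀ (l : ℕ) (t : Fin (l + 1) → ℝ≥0), Monotone t → ∀ x : Fin (l + 1) → E,
      Pr {ω | ∀ i, Z (t i) ω = x i} =
        ENNReal.ofReal (P (t 0) x₀ (x 0) *
          ∏ i : Fin l, P (t i.succ - t i.castSucc) (x i.castSucc) (x i.succ))

/-- The first time, in `[0, ∞]`, at which the process `Z` is in the set `A`. -/
noncomputable def hittingTime {E Ω : Type*} (Z : ℝ≥0 → Ω → E) (A : Set E) : Ω → ℝ≥0∞ :=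
  hittingAfter Z A 0

/-- The transition rates of the chain on `{0, …, n} × {0, …, k}`. -/
noncomputable def codedRate (n k : ℕ) (μ₁ μ₂ ε : ℝ) (x y : Fin (n + 1) × Fin (k + 1)) : ℝ :=
  let u : ℕ := x.1
  let v : ℕ := x.2
  if ((y.1 : ℕ) = u + 1 ∧ (y.2 : ℕ) = v) ∧ v ≤ u ∧ u < n then ((n : ℝ) - u) * μ₁
  else if ((y.1 : ℕ) = u ∧ (y.2 : ℕ) = v + 1) ∧ v < min u k then ((u : ℝ) - v) * (1 - ε) * μ₂
  else 0

/-! ### The overall run-time of the coded computation -/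

/-- All random variables of the system in one family (`N` is viewed as real-valued): computation
times, numbers of transmissions, transmission times. -/
def systemVars {n R : ℕ} {Ω : Type*} (X : Fin n → Ω → ℝ) (N : Fin n → Fin R → Ω → ℕ)
    (Y : Fin n → Fin R → ℕ → Ω → ℝ) :
    Fin n ⊕ (Fin n × Fin R) ⊕ (Fin n × Fin R × ℕ) → Ω → ℝ
  | Sum.inl i => X i
  | Sum.inr (Sum.inl (i, r)) => fun ω => (N i r ω : ℝ)
  | Sum.inr (Sum.inr (i, r, j)) => Y i r j

/-- The random variables of `n` workers, each of which computes `m / k` inner products and sends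
each of them in one packet over a packet erasure channel with erasure probability `ε`:
* `X i` is the computation time of worker `i`, exponential with rate `k μ₁ / m`;
* `N i r` is the number of transmissions that worker `i` needs for its `r`-th inner product,
  geometric on `{1, 2, …}` with success probability `1 - ε`;
* `Y i r j` is the duration of the `j`-th of these transmissions (`j` counts from `0`),
  exponential with rate `μ₂`;
and all of them are mutually independent. -/
structure IsCodedSystem {n : ℕ} (m k : ℕ) (μ₁ μ₂ ε : ℝ) {Ω : Type*} [MeasurableSpace Ω]
    (Pr : Measure Ω) (X : Fin n → Ω → ℝ) (N : Fin n → Fin (m / k) → Ω → ℕ)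
    (Y : Fin n → Fin (m / k) → ℕ → Ω → ℝ) : Prop where
  measurable_X : ∀ i, Measurable (X i)
  measurable_N : ∀ i r, Measurable (N i r)
  measurable_Y : ∀ i r j, Measurable (Y i r j)
  law_X : ∀ i, Pr.map (X i) = expMeasure ((k : ℝ) * μ₁ / m)
  law_N : ∀ i r (l : ℕ), 1 ≤ l →
    Pr {ω | N i r ω = l} = ENNReal.ofReal ((1 - ε) * ε ^ (l - 1))
  law_Y : ∀ i r j, Pr.map (Y i r j) = expMeasure μ₂
  indep : iIndepFun (systemVars X N Y) Pr

/-- The total communication time `S i` of worker `i`. -/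
def commTime {n R : ℕ} {Ω : Type*} (N : Fin n → Fin R → Ω → ℕ)
    (Y : Fin n → Fin R → ℕ → Ω → ℝ) (i : Fin n) (ω : Ω) : ℝ :=
  ∑ r : Fin R, ∑ j ∈ Finset.range (N i r ω), Y i r j ω

/-- The `k`-th smallest of the `n` numbers `a 0, …, a (n - 1)`, counted with multiplicity. -/
noncomputable def kthMin {n : ℕ} (a : Fin n → ℝ) (k : ℕ) (hk : 1 ≤ k ∧ k ≤ n) : ℝ :=
  a (Tuple.sort a ⟨k - 1, by omega⟩)

/-- The overall run-time `T`: the `k`-th smallest of the completion times `X i + S i`. -/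
noncomputable def runTime {n R : ℕ} {Ω : Type*} (X : Fin n → Ω → ℝ) (N : Fin n → Fin R → Ω → ℕ)
    (Y : Fin n → Fin R → ℕ → Ω → ℝ) (k : ℕ) (hk : 1 ≤ k ∧ k ≤ n) (ω : Ω) : ℝ :=
  kthMin (fun i => X i ω + commTime N Y i ω) k hk

/-!
The hitting time `τ` and the run-time `T` have the same law, hence the same expectation: both
distribution functions are, at `t ≥ 0`, the probability that a binomial variable with parameters `n`
and `c t` is at least `k`, where `c t = sumCdf μ₁ ((1 - ε) * μ₂) t`.

For the run-time this is direct. A sum of a geometric number of independent exponential variables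
is exponential (`map_geometric_sum`), so that every worker finishes by time `t` with probability
`c t` (`measureReal_add_le`); the workers are independent, and `T ≤ t` means that at least `k` of
them have finished (`kthMin_le_iff`, `measure_le_card_filter`).

For the chain, the set `v = k` is closed, so that `τ ≤ t` is almost surely the event that the
chain is in that set at time `t` (`IsMarkovChainFrom.measure_hittingTime_le`). Off that set the
transition probabilities from `(0, 0)` solve a linear system of differential equations, the
Kolmogorov forward equation (`HasTransitionRates.hasDerivWithinAt`). The joint probabilities of
the number `u` of workers that have computed and the number `v` of workers that have also
communicated, which are trinomial (`workersProb`), solve the same system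
(`hasDerivAt_workersProb`, `aliveProb_forward_equation`), so that by uniqueness the two agree for
`v < k`. Summing over `u` gives the binomial law of `v` (`sum_workersProb`).
-/

/-! ### Kolmogorov forward equation -/

/-- Solutions of a linear system `f' = f M` of ordinary differential equations on `[0, ∞)` are
determined by their value at `0`; right derivatives suffice. -/
theorem eq_of_linear_ode {E : Type*} [Fintype E] (M : E → E → ℝ) (f g : ℝ → E → ℝ)
    (hf : ∀ y, ContinuousOn (fun t => f t y) (Ici 0))
    (hf' : ∀ t, 0 ≤ t → ∀ y,
      HasDerivWithinAt (fun t => f t y) (∑ z, f t z * M z y) (Ici t) t)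
    (hg : ∀ y, ContinuousOn (fun t => g t y) (Ici 0))
    (hg' : ∀ t, 0 ≤ t → ∀ y,
      HasDerivWithinAt (fun t => g t y) (∑ z, g t z * M z y) (Ici t) t)
    (h0 : f 0 = g 0) {t : ℝ} (ht : 0 ≤ t) : f t = g t := by
  let L : (E → ℝ) →L[ℝ] (E → ℝ) := LinearMap.toContinuousLinearMap
    { toFun := fun w y => ∑ z, w z * M z y
      map_add' := fun w w' => by
        ext y; simp [add_mul, Finset.sum_add_distrib]
      map_smul' := fun c w => by
        ext y; simp [Finset.mul_sum, mul_assoc] }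
  have hL : ∀ w, L w = fun y => ∑ z, w z * M z y := fun w => rfl
  refine ODE_solution_unique (v := fun _ w => L w) (K := ‖L‖₊) (a := 0) (b := t)
    (fun _ => L.lipschitz) ?_ ?_ ?_ ?_ h0 ⟨ht, le_rfl⟩
  · exact continuousOn_pi.2 fun y => (hf y).mono Icc_subset_Ici_self
  · intro s hs
    rw [hasDerivWithinAt_pi]
    exact fun y => hf' s hs.1 y
  · exact continuousOn_pi.2 fun y => (hg y).mono Icc_subset_Ici_self
  · intro s hs
    rw [hasDerivWithinAt_pi]
    exact fun y => hg' s hs.1 y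

/-- The generator matrix of transition rates `q`: off the diagonal it agrees with `q`, and its rows
sum to `0`. -/
noncomputable def generator {E : Type*} [Fintype E] [DecidableEq E] (q : E → E → ℝ)
    (x y : E) : ℝ :=
  if x = y then -∑ z ∈ Finset.univ.erase x, q x z else q x y

section Transition

variable {E : Type*} [Fintype E] [DecidableEq E] {P : ℝ≥0 → Matrix E E ℝ} {q : E → E → ℝ}

theorem IsTransitionFunction.le_one (hP : IsTransitionFunction P) (t : ℝ≥0) (x y : E) :
    P t x y ≤ 1 := by
  rw [← hP.row_sum t x]
  exact Finset.single_le_sum (fun z _ => hP.nonneg t x z) (Finset.mem_univ y)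

/-- The generator is the right derivative of `P` at `0`, on the diagonal too: there it is forced by
the row sums. -/
theorem HasTransitionRates.tendsto_generator (hP : IsTransitionFunction P)
    (hq : HasTransitionRates P q) (x y : E) :
    Tendsto (fun h : ℝ≥0 => (P h x y - (1 : Matrix E E ℝ) x y) / (h : ℝ)) (𝓝[>] 0)
      (𝓝 (generator q x y)) := by
  unfold generator
  split_ifs with hxy
  · subst hxy
    have h1 : ∀ h : ℝ≥0, (P h x x - (1 : Matrix E E ℝ) x x) / (h : ℝ)
        = -∑ z ∈ Finset.univ.erase x, P h x z / (h : ℝ) := by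
      intro h
      have := hP.row_sum h x
      rw [← Finset.add_sum_erase _ _ (Finset.mem_univ x)] at this
      rw [← Finset.sum_div, Matrix.one_apply_eq, ← neg_div]
      congr 1
      linarith
    simp_rw [h1]
    refine (tendsto_finsetSum _ fun z hz => ?_).neg
    exact hq x z (Finset.ne_of_mem_erase hz).symm
  · simpa [Matrix.one_apply_ne hxy] using hq x y hxy

theorem HasTransitionRates.tendsto_one (hP : IsTransitionFunction P)
    (hq : HasTransitionRates P q) (x y : E) :
    Tendsto (fun h : ℝ≥0 => P h x y) (𝓝 0) (𝓝 ((1 : Matrix E E ℝ) x y)) := by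
  have h0 : P 0 x y = (1 : Matrix E E ℝ) x y := by rw [hP.zero]
  rw [← h0]
  change ContinuousAt (fun h : ℝ≥0 => P h x y) 0
  rw [continuousAt_iff_punctured_nhds, h0]
  have hne : (𝓝[≠] (0 : ℝ≥0)) = 𝓝[>] 0 := by
    congr 1; ext h; simp [pos_iff_ne_zero]
  rw [hne]
  have h1 := (hq.tendsto_generator hP x y).mul
    ((NNReal.continuous_coe.tendsto 0).mono_left (nhdsWithin_le_nhds (s := Ioi (0 : ℝ≥0))))
  have h2 := h1.add_const ((1 : Matrix E E ℝ) x y)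
  simp only [NNReal.coe_zero, mul_zero, zero_add] at h2
  refine h2.congr' ?_
  filter_upwards [self_mem_nhdsWithin] with h hh
  have : (h : ℝ) ≠ 0 := by
    have : (0 : ℝ≥0) < h := hh
    positivity
  field_simp
  ring

theorem IsTransitionFunction.add_sub (hP : IsTransitionFunction P) (s h : ℝ≥0) (x y : E) :
    P (s + h) x y - P s x y = ∑ z, P s x z * (P h z y - (1 : Matrix E E ℝ) z y) := by
  have : P s x y = (P s * (1 : Matrix E E ℝ)) x y := by rw [mul_one]
  rw [hP.add, this, Matrix.mul_apply, Matrix.mul_apply, ← Finset.sum_sub_distrib]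
  simp_rw [mul_sub]

/-- The forward equation only gives right derivatives, so two-sided continuity in time, which the
uniqueness theorem needs, is a separate fact. -/
theorem HasTransitionRates.continuous (hP : IsTransitionFunction P)
    (hq : HasTransitionRates P q) (x y : E) : Continuous fun t : ℝ≥0 => P t x y := by
  -- a modulus of continuity that is uniform in time
  let w : ℝ≥0 → ℝ := fun h => ∑ z, |P h z y - (1 : Matrix E E ℝ) z y|
  have hw : Tendsto w (𝓝 0) (𝓝 0) := by
    have : Tendsto w (𝓝 0) (𝓝 (∑ z : E, |(1 : Matrix E E ℝ) z y - (1 : Matrix E E ℝ) z y|)) :=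
      tendsto_finsetSum _ fun z _ => ((hq.tendsto_one hP z y).sub_const _).abs
    simpa using this
  have key : ∀ s h, |P (s + h) x y - P s x y| ≤ w h := by
    intro s h
    rw [hP.add_sub]
    refine (Finset.abs_sum_le_sum_abs _ _).trans (Finset.sum_le_sum fun z _ => ?_)
    rw [abs_mul, abs_of_nonneg (hP.nonneg s x z)]
    exact mul_le_of_le_one_left (abs_nonneg _) (hP.le_one s x z)
  have key2 : ∀ s t, |P s x y - P t x y| ≤ w (nndist s t) := by
    intro s t
    rcases le_total s t with h | h
    · obtain ⟨d, rfl⟩ := exists_add_of_le h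
      have hd : nndist s (s + d) = d := by
        ext; simp [NNReal.dist_eq]
      rw [hd, abs_sub_comm]
      exact key s d
    · obtain ⟨d, rfl⟩ := exists_add_of_le h
      have hd : nndist (t + d) t = d := by
        ext; simp [NNReal.dist_eq]
      rw [hd]
      exact key t d
  rw [continuous_iff_continuousAt]
  intro t
  rw [ContinuousAt, tendsto_iff_dist_tendsto_zero]
  refine squeeze_zero (fun _ => dist_nonneg) (fun s => key2 s t) (hw.comp ?_)
  have : Continuous fun s : ℝ≥0 => nndist s t := by fun_prop
  simpa using this.tendsto t

/-- The Kolmogorov forward equation. -/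
theorem HasTransitionRates.hasDerivWithinAt (hP : IsTransitionFunction P)
    (hq : HasTransitionRates P q) (x y : E) {t : ℝ} (ht : 0 ≤ t) :
    HasDerivWithinAt (fun s : ℝ => P s.toNNReal x y)
      (∑ z, P t.toNNReal x z * generator q z y) (Ici t) t := by
  rw [hasDerivWithinAt_iff_tendsto_slope, Ici_sdiff_left]
  have hlim : Tendsto (fun s : ℝ => (s - t).toNNReal) (𝓝[>] t) (𝓝[>] 0) := by
    refine tendsto_nhdsWithin_iff.2 ⟨?_, ?_⟩
    · have : Continuous fun s : ℝ => (s - t).toNNReal := by fun_prop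
      simpa using (this.tendsto t).mono_left nhdsWithin_le_nhds
    · filter_upwards [self_mem_nhdsWithin] with s hs
      have : t < s := hs
      simpa using this
  have h1 : Tendsto (fun s : ℝ => ∑ z, P t.toNNReal x z *
      ((P (s - t).toNNReal z y - (1 : Matrix E E ℝ) z y) / ((s - t).toNNReal : ℝ))) (𝓝[>] t)
      (𝓝 (∑ z, P t.toNNReal x z * generator q z y)) :=
    tendsto_finsetSum _ fun z _ => ((hq.tendsto_generator hP z y).comp hlim).const_mul _
  refine h1.congr' ?_
  filter_upwards [self_mem_nhdsWithin] with s hs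
  have hs : t < s := hs
  have hst : s.toNNReal = t.toNNReal + (s - t).toNNReal := by
    rw [← Real.toNNReal_add ht (by linarith)]; congr 1; ring
  rw [slope_def_field, hst, hP.add_sub, Real.coe_toNNReal _ (by linarith : 0 ≤ s - t),
    Finset.sum_div]
  simp_rw [mul_div_assoc]

/-- Off a set `A` that the chain cannot leave, the transition probabilities are determined by the
Kolmogorov forward equation there. -/
theorem HasTransitionRates.eq_of_forward_equation (hP : IsTransitionFunction P)
    (hq : HasTransitionRates P q) {A : Set E} (hA : ∀ x ∈ A, ∀ y ∉ A, q x y = 0) (x : E)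
    (g : ℝ → E → ℝ) (hgA : ∀ t, ∀ y ∈ A, g t y = 0)
    (hg : ∀ y ∉ A, ContinuousOn (fun t => g t y) (Ici 0))
    (hg' : ∀ t, 0 ≤ t → ∀ y ∉ A,
      HasDerivWithinAt (fun t => g t y) (∑ z, g t z * generator q z y) (Ici t) t)
    (h0 : ∀ y ∉ A, g 0 y = (1 : Matrix E E ℝ) x y) (t : ℝ≥0) {y : E} (hy : y ∉ A) :
    P t x y = g t y := by
  classical
  have key := eq_of_linear_ode (fun z y => if y ∈ A then 0 else generator q z y)
    (fun s y => if y ∈ A then 0 else P s.toNNReal x y) g ?_ ?_ ?_ ?_ ?_ t.coe_nonneg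
  · have := congrFun key y
    simpa [hy] using this
  · intro y
    by_cases hy : y ∈ A
    · simpa [hy] using continuousOn_const
    · simpa [hy, Function.comp_def] using
        ((hq.continuous hP x y).comp continuous_real_toNNReal).continuousOn
  · intro s hs y
    by_cases hy : y ∈ A
    · simpa [hy] using hasDerivWithinAt_const s (Ici s) (0 : ℝ)
    · simp only [hy, if_false]
      convert! hq.hasDerivWithinAt hP x y hs using 1
      refine Finset.sum_congr rfl fun z _ => ?_
      by_cases hz : z ∈ A
      · have hzy : z ≠ y := fun h => hy (h ▸ hz)
        simp [generator, hzy, hA z hz y hy]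
      · simp [hz]
  · intro y
    by_cases hy : y ∈ A
    · simpa [hgA _ y hy] using continuousOn_const
    · exact hg y hy
  · intro s hs y
    by_cases hy : y ∈ A
    · simpa [hy, hgA _ y hy] using hasDerivWithinAt_const s (Ici s) (0 : ℝ)
    · simpa [hy] using hg' s hs y hy
  · ext y
    by_cases hy : y ∈ A
    · simp [hy, hgA _ y hy]
    · simp [hy, h0 y hy, hP.zero]

/-- A chain does not leave a set out of which all rates vanish: off the set, the zero function
solves the forward equation with the initial value of a chain started in the set. -/
theorem HasTransitionRates.eq_zero_of_closed (hP : IsTransitionFunction P)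
    (hq : HasTransitionRates P q) {A : Set E} (hA : ∀ x ∈ A, ∀ y ∉ A, q x y = 0) (t : ℝ≥0)
    {x y : E} (hx : x ∈ A) (hy : y ∉ A) : P t x y = 0 := by
  refine hq.eq_of_forward_equation hP hA x (fun _ _ => 0) (fun _ _ _ => rfl)
    (fun _ _ => continuousOn_const) ?_ ?_ t hy
  · intro s _ y _
    simpa using hasDerivWithinAt_const s (Ici s) (0 : ℝ)
  · intro y hy
    have hxy : x ≠ y := fun h => hy (h ▸ hx)
    exact (Matrix.one_apply_ne hxy).symm

end Transition

/-! ### Hitting times of absorbing sets -/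

section Hitting

variable {E Ω : Type*} {Z : ℝ≥0 → Ω → E}

/-- The hitting time of a right-continuous process is attained. -/
theorem hittingTime_le_iff (hZ : ∀ ω t, ∀ᶠ s in 𝓝[≥] t, Z s ω = Z t ω) (A : Set E) (ω : Ω)
    (t : ℝ≥0) : hittingTime Z A ω ≤ t ↔ ∃ s ≤ t, Z s ω ∈ A := by
  classical
  unfold hittingTime hittingAfter
  set S : Set ℝ≥0 := {i : ℝ≥0 | 0 ≤ i ∧ Z i ω ∈ A} with hS
  split_ifs with h
  · have hne : S.Nonempty := h
    have hmem : Z (sInf S) ω ∈ A := by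
      have hcl : sInf S ∈ closure S := csInf_mem_closure hne (OrderBot.bddBelow S)
      have hge : ∀ s ∈ S, sInf S ≤ s := fun s hs => csInf_le (OrderBot.bddBelow S) hs
      rw [mem_closure_iff_frequently] at hcl
      have hfr : ∃ᶠ s in 𝓝[≥] (sInf S), s ∈ S := by
        rw [frequently_nhdsWithin_iff]
        exact hcl.mono fun s hs => ⟨hs, hge s hs⟩
      obtain ⟨s, hs, hs'⟩ := (hfr.and_eventually (hZ ω (sInf S))).exists
      rw [← hs']
      exact hs.2
    have hcast : (((sInf S : ℝ≥0) : WithTop ℝ≥0) : ℝ≥0∞) ≤ (t : ℝ≥0∞) ↔ sInf S ≤ t :=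
      ENNReal.coe_le_coe
    refine hcast.trans ⟨fun hle => ⟨_, hle, hmem⟩, ?_⟩
    rintro ⟨s, hst, hs⟩
    exact (csInf_le (OrderBot.bddBelow S) ⟨zero_le, hs⟩).trans hst
  · refine ⟨fun hle => ?_, ?_⟩
    · exact absurd (hle.trans_lt ENNReal.coe_lt_top) (lt_irrefl _)
    · rintro ⟨s, -, hs⟩
      exact absurd ⟨s, zero_le, hs⟩ h

/-- By right-continuity, visits to `A` before time `t` can be seen at countably many times. -/
theorem exists_mem_iff_exists_denseSeq (hZ : ∀ ω t, ∀ᶠ s in 𝓝[≥] t, Z s ω = Z t ω) (A : Set E)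
    (ω : Ω) (t : ℝ≥0) : (∃ s ≤ t, Z s ω ∈ A) ↔
      Z t ω ∈ A ∨ ∃ n : ℕ, TopologicalSpace.denseSeq ℝ≥0 n ≤ t ∧
        Z (TopologicalSpace.denseSeq ℝ≥0 n) ω ∈ A := by
  constructor
  · rintro ⟨s, hst, hs⟩
    rcases hst.eq_or_lt with rfl | hlt
    · exact Or.inl hs
    right
    have h1 : ∀ᶠ r in 𝓝[>] s, Z r ω = Z s ω :=
      (hZ ω s).filter_mono (nhdsWithin_mono _ Ioi_subset_Ici_self)
    obtain ⟨u, hu, hu'⟩ := (mem_nhdsGT_iff_exists_Ioo_subset' hlt).1 h1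
    have hop : IsOpen (Ioo s (min u t)) := isOpen_Ioo
    have hne : (Ioo s (min u t)).Nonempty := nonempty_Ioo.2 (lt_min hu hlt)
    obtain ⟨n, hn⟩ := (TopologicalSpace.denseRange_denseSeq ℝ≥0).exists_mem_open hop hne
    refine ⟨n, (hn.2.trans_le (min_le_right _ _)).le, ?_⟩
    have : Z (TopologicalSpace.denseSeq ℝ≥0 n) ω = Z s ω :=
      hu' ⟨hn.1, hn.2.trans_le (min_le_left _ _)⟩
    rwa [this]
  · rintro (h | ⟨n, hn, h⟩)
    · exact ⟨t, le_rfl, h⟩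
    · exact ⟨_, hn, h⟩

variable [Fintype E] [DecidableEq E] [MeasurableSpace Ω] {Pr : Measure Ω} {q : E → E → ℝ} {x₀ : E}

theorem IsMarkovChainFrom.measurableSet_mem (hZ : IsMarkovChainFrom q x₀ Z Pr) (t : ℝ≥0)
    (A : Set E) : MeasurableSet {ω | Z t ω ∈ A} := by
  have : {ω | Z t ω ∈ A} = ⋃ x ∈ A, {ω | Z t ω = x} := by ext; simp
  rw [this]
  exact MeasurableSet.biUnion A.to_countable fun x _ => hZ.measurable t x

theorem IsMarkovChainFrom.measurable_hittingTime (hZ : IsMarkovChainFrom q x₀ Z Pr) (A : Set E) :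
    Measurable (hittingTime Z A) := by
  refine measurable_of_Iic fun a => ?_
  induction a with
  | top => simp
  | coe t =>
    have : hittingTime Z A ⁻¹' Iic (t : ℝ≥0∞) = {ω | Z t ω ∈ A} ∪
        ⋃ n : ℕ, {ω | TopologicalSpace.denseSeq ℝ≥0 n ≤ t ∧
          Z (TopologicalSpace.denseSeq ℝ≥0 n) ω ∈ A} := by
      ext ω
      simp only [mem_preimage, mem_Iic, hittingTime_le_iff hZ.right_continuous,
        exists_mem_iff_exists_denseSeq hZ.right_continuous, mem_union, mem_iUnion, mem_ofPred_eq]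
    rw [this]
    refine (hZ.measurableSet_mem t A).union (MeasurableSet.iUnion fun n => ?_)
    exact (MeasurableSet.const _).inter (hZ.measurableSet_mem _ A)

/-- If the rates out of `A` vanish then the chain stays in `A` almost surely, so that it has hit
`A` by time `t` if and only if it is in `A` at time `t`. -/
theorem IsMarkovChainFrom.measure_hittingTime_le (hZ : IsMarkovChainFrom q x₀ Z Pr) {A : Set E}
    (hA : ∀ x ∈ A, ∀ y ∉ A, q x y = 0) (t : ℝ≥0) :
    Pr {ω | hittingTime Z A ω ≤ t} = Pr {ω | Z t ω ∈ A} := by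
  obtain ⟨P, hP, hq, hfd⟩ := hZ.markov
  -- being in `A` at time `s` and outside at the later time `t` has probability `0`
  have hstep : ∀ s ≤ t, Pr {ω | Z s ω ∈ A ∧ Z t ω ∉ A} = 0 := by
    intro s hst
    have hsub : {ω | Z s ω ∈ A ∧ Z t ω ∉ A} ⊆
        ⋃ x ∈ A, ⋃ y ∈ Aᶜ, {ω | Z s ω = x ∧ Z t ω = y} := by
      intro ω hω
      simp only [mem_iUnion]
      exact ⟨_, hω.1, _, hω.2, rfl, rfl⟩
    refine measure_mono_null hsub ?_
    rw [measure_biUnion_null_iff A.to_countable]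
    intro x hx
    rw [measure_biUnion_null_iff (Aᶜ).to_countable]
    intro y hy
    have h2 := hfd 1 ![s, t] (by
      intro i j hij
      fin_cases i <;> fin_cases j <;> first | exact le_rfl | exact hst | simp at hij) ![x, y]
    have hset : {ω | ∀ i, Z (![s, t] i) ω = ![x, y] i} = {ω | Z s ω = x ∧ Z t ω = y} := by
      ext ω; simp [Fin.forall_fin_two]
    rw [hset] at h2
    rw [h2]
    simp [hq.eq_zero_of_closed hP hA (t - s) hx hy]
  refine le_antisymm ?_ (measure_mono fun ω hω =>
    (hittingTime_le_iff hZ.right_continuous A ω t).2 ⟨t, le_rfl, hω⟩)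
  have hsub : {ω | hittingTime Z A ω ≤ t} ⊆ {ω | Z t ω ∈ A} ∪
      ⋃ n : ℕ, {ω | TopologicalSpace.denseSeq ℝ≥0 n ≤ t ∧
        (Z (TopologicalSpace.denseSeq ℝ≥0 n) ω ∈ A ∧ Z t ω ∉ A)} := by
    intro ω hω
    rw [mem_ofPred_eq, hittingTime_le_iff hZ.right_continuous,
      exists_mem_iff_exists_denseSeq hZ.right_continuous] at hω
    by_cases ht : Z t ω ∈ A
    · exact Or.inl ht
    · obtain ⟨n, hn, hn'⟩ := hω.resolve_left ht
      exact Or.inr (mem_iUnion.2 ⟨n, hn, hn', ht⟩)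
  refine (measure_mono hsub).trans ((measure_union_le _ _).trans ?_)
  rw [measure_iUnion_null, add_zero]
  intro n
  by_cases hn : TopologicalSpace.denseSeq ℝ≥0 n ≤ t
  · simpa [hn] using hstep _ hn
  · simp [hn]

/-- If `g` solves the Kolmogorov forward equation off an absorbing set `A`, with the initial value
of a chain that starts outside `A`, then the chain has not hit `A` by time `t` with probability
`∑ y, g t y`. -/
theorem IsMarkovChainFrom.measure_hittingTime_le_eq
    (hZ : IsMarkovChainFrom q x₀ Z Pr) {A : Set E} (hA : ∀ x ∈ A, ∀ y ∉ A, q x y = 0)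
    (g : ℝ → E → ℝ) (hgA : ∀ t, ∀ y ∈ A, g t y = 0)
    (hg : ∀ y ∉ A, ContinuousOn (fun t => g t y) (Ici 0))
    (hg' : ∀ t, 0 ≤ t → ∀ y ∉ A,
      HasDerivWithinAt (fun t => g t y) (∑ z, g t z * generator q z y) (Ici t) t)
    (h0 : ∀ y ∉ A, g 0 y = (1 : Matrix E E ℝ) x₀ y) (t : ℝ≥0) :
    Pr {ω | hittingTime Z A ω ≤ t} = ENNReal.ofReal (1 - ∑ y, g t y) := by
  classical
  rw [hZ.measure_hittingTime_le hA]
  obtain ⟨P, hP, hq, hfd⟩ := hZ.markov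
  have h1 : ∀ y, Pr {ω | Z t ω = y} = ENNReal.ofReal (P t x₀ y) := by
    intro y
    have := hfd 0 (fun _ => t) (fun _ _ _ => le_rfl) (fun _ => y)
    simpa using this
  have h2 : Pr {ω | Z t ω ∈ A} = ∑ y ∈ Finset.univ.filter (· ∈ A), Pr {ω | Z t ω = y} := by
    rw [← measure_biUnion_finset]
    · congr 1
      ext ω; simp
    · intro y _ y' _ hyy'
      refine Set.disjoint_left.2 fun ω hω hω' => hyy' ?_
      exact hω.symm.trans hω'
    · exact fun y _ => hZ.measurable t y
  rw [h2, Finset.sum_congr rfl fun y _ => h1 y,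
    ← ENNReal.ofReal_sum_of_nonneg fun y _ => hP.nonneg t x₀ y]
  congr 1
  have h3 : ∑ y, g t y = ∑ y ∈ Finset.univ.filter (· ∉ A), P t x₀ y := by
    rw [Finset.sum_filter]
    refine Finset.sum_congr rfl fun y _ => ?_
    split_ifs with hy
    · exact hgA t y hy
    · exact (hq.eq_of_forward_equation hP hA x₀ g hgA hg hg' h0 t hy).symm
  have h4 := Finset.sum_filter_add_sum_filter_not Finset.univ (· ∈ A) fun y => P t x₀ y
  rw [hP.row_sum t x₀] at h4
  linarith

end Hitting

/-! ### Trinomial probabilities of the workers' progress -/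

/-- The distribution function, at times `t ≥ 0`, of `X + S` for independent exponential `X` of rate
`μ` and `S` of rate `ν`, as the integral over the value `s` of `S`. -/
noncomputable def sumCdf (μ ν t : ℝ) : ℝ :=
  ∫ s in (0 : ℝ)..t, ν * Real.exp (-(ν * s)) * (1 - Real.exp (-(μ * (t - s))))

theorem sumCdf_zero (μ ν : ℝ) : sumCdf μ ν 0 = 0 := by simp [sumCdf]

/-- With `a = exp (-(μ * t))` the probability that `X > t`, and `c` that `X + S ≤ t`, the
derivative of `c` is `ν` times the probability `1 - a - c` that `X ≤ t < X + S`. -/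
theorem hasDerivAt_sumCdf (μ ν t : ℝ) :
    HasDerivAt (sumCdf μ ν) (ν * (1 - Real.exp (-(μ * t)) - sumCdf μ ν t)) t := by
  -- substituting `w = t - s` moves `t` out of the integrand
  have h1 : ∀ t, sumCdf μ ν t = Real.exp (-(ν * t)) *
      ∫ w in (0 : ℝ)..t, ν * Real.exp (ν * w) * (1 - Real.exp (-(μ * w))) := by
    intro t
    have h2 := intervalIntegral.integral_comp_sub_left (a := 0) (b := t)
      (fun w => ν * Real.exp (-(ν * (t - w))) * (1 - Real.exp (-(μ * w)))) t
    simp only [sub_sub_cancel, sub_self, sub_zero] at h2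
    rw [sumCdf, h2, ← intervalIntegral.integral_const_mul]
    refine intervalIntegral.integral_congr fun w _ => ?_
    have : Real.exp (-(ν * (t - w))) = Real.exp (-(ν * t)) * Real.exp (ν * w) := by
      rw [← Real.exp_add]; congr 1; ring
    simp only [this]
    ring
  have h3 : HasDerivAt (fun t => ∫ w in (0 : ℝ)..t,
      ν * Real.exp (ν * w) * (1 - Real.exp (-(μ * w))))
      (ν * Real.exp (ν * t) * (1 - Real.exp (-(μ * t)))) t := by
    have hc : Continuous fun w => ν * Real.exp (ν * w) * (1 - Real.exp (-(μ * w))) := by fun_prop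
    exact (hc.integral_hasStrictDerivAt 0 t).hasDerivAt
  have h4 : HasDerivAt (fun t => Real.exp (-(ν * t))) (Real.exp (-(ν * t)) * -ν) t := by
    have := ((hasDerivAt_id t).const_mul ν).neg.exp
    simpa using this
  have h5 := h4.mul h3
  have h6 : Real.exp (-(ν * t)) * Real.exp (ν * t) = 1 := by
    rw [← Real.exp_add]; simp
  refine (h5.congr_of_eventuallyEq (Eventually.of_forall h1)).congr_deriv ?_
  rw [h1 t]
  linear_combination (ν * (1 - Real.exp (-(μ * t)))) * h6

/-- The probability that, at time `t`, exactly `u` of `n` independent workers have finished their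
computation and exactly `v` of them their communication too: a trinomial probability, since at time
`t` each worker is still computing, is communicating, or has finished both. -/
noncomputable def workersProb (n : ℕ) (μ ν t : ℝ) (u v : ℕ) : ℝ :=
  (n.choose u * u.choose v : ℕ) * Real.exp (-(μ * t)) ^ (n - u) *
    (1 - Real.exp (-(μ * t)) - sumCdf μ ν t) ^ (u - v) * sumCdf μ ν t ^ v

theorem workersProb_of_lt {n : ℕ} {μ ν t : ℝ} {u v : ℕ} (h : u < v) :
    workersProb n μ ν t u v = 0 := by
  simp [workersProb, Nat.choose_eq_zero_of_lt h]

theorem workersProb_zero {n : ℕ} {μ ν : ℝ} {u v : ℕ} :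
    workersProb n μ ν 0 u v = if u = 0 ∧ v = 0 then 1 else 0 := by
  rcases lt_or_ge u v with h | h
  · rw [workersProb_of_lt h, if_neg (by omega)]
  simp only [workersProb, sumCdf_zero, mul_zero, neg_zero, Real.exp_zero, one_pow, sub_self,
    mul_one]
  split_ifs with h0
  · simp [h0.1, h0.2]
  · by_cases hv : v = 0
    · have : u - v ≠ 0 := by omega
      simp [this]
    · simp [hv]

/-- The Kolmogorov forward equation for the numbers of workers that have finished their computation
and their communication. The predecessors of `(u, v)` are `(u - 1, v)` and `(u, v - 1)`, if they
exist. -/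
theorem hasDerivAt_workersProb {n : ℕ} (μ ν t : ℝ) {u v : ℕ} (hu : u ≤ n) (hv : v ≤ u) :
    HasDerivAt (fun t => workersProb n μ ν t u v)
      (-((((n : ℝ) - u) * μ + ((u : ℝ) - v) * ν) * workersProb n μ ν t u v) +
        (if u = 0 then 0 else ((n : ℝ) - (u - 1 : ℕ)) * μ * workersProb n μ ν t (u - 1) v) +
        (if v = 0 then 0 else ((u : ℝ) - (v - 1 : ℕ)) * ν * workersProb n μ ν t u (v - 1))) t := by
  have ha : HasDerivAt (fun t => Real.exp (-(μ * t))) (-μ * Real.exp (-(μ * t))) t := by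
    have := ((hasDerivAt_id t).const_mul μ).neg.exp
    simpa [mul_comm] using this
  have hc := hasDerivAt_sumCdf μ ν t
  have hb := (ha.const_sub 1).sub hc
  have h := (((ha.fun_pow (n - u)).const_mul ((n.choose u * u.choose v : ℕ) : ℝ)).mul
    (hb.fun_pow (u - v))).mul (hc.fun_pow v)
  refine h.congr_deriv ?_
  obtain ⟨d, rfl⟩ := Nat.exists_eq_add_of_le hv
  obtain ⟨e, rfl⟩ := Nat.exists_eq_add_of_le hu
  -- the inflow through a completed computation
  have hcomp : (if v + d = 0 then 0 else (((v + d + e : ℕ) : ℝ) - (v + d - 1 : ℕ)) * μ *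
        workersProb (v + d + e) μ ν t (v + d - 1) v) =
      d * μ * (((v + d + e).choose (v + d) * (v + d).choose v : ℕ) *
        Real.exp (-(μ * t)) ^ (e + 1) *
        (1 - Real.exp (-(μ * t)) - sumCdf μ ν t) ^ (d - 1) * sumCdf μ ν t ^ v) := by
    rcases d with _ | d
    · split_ifs with h0
      · simp
      · rw [workersProb_of_lt (by omega)]
        simp
    · have h1 := Nat.choose_succ_right_eq (v + (d + 1) + e) (v + d)
      have h2 := Nat.choose_mul_succ_eq (v + d) v
      rw [show v + (d + 1) + e - (v + d) = e + 1 by omega] at h1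
      rw [show v + d + 1 - v = d + 1 by omega] at h2
      have h1' := congrArg (Nat.cast : ℕ → ℝ) h1
      have h2' := congrArg (Nat.cast : ℕ → ℝ) h2
      rw [if_neg (by omega), workersProb, show v + (d + 1) - 1 = v + d by omega,
        show v + (d + 1) + e - (v + d) = e + 1 by omega, Nat.add_sub_cancel_left,
        Nat.add_sub_cancel, show v + (d + 1) = v + d + 1 by omega] at *
      push_cast at h1' h2' ⊢
      generalize (Nat.choose (v + d + 1 + e) (v + d) : ℝ) = A at *
      generalize (Nat.choose (v + d + 1 + e) (v + d + 1) : ℝ) = A' at *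
      generalize (Nat.choose (v + d) v : ℝ) = B at *
      generalize (Nat.choose (v + d + 1) v : ℝ) = B' at *
      linear_combination (-B * h1' + A' * h2') *
        (μ * Real.exp (-(μ * t)) ^ (e + 1) *
        (1 - Real.exp (-(μ * t)) - sumCdf μ ν t) ^ d * sumCdf μ ν t ^ v)
  -- the inflow through a completed communication
  have hcomm : (if v = 0 then 0 else (((v + d : ℕ) : ℝ) - (v - 1 : ℕ)) * ν *
        workersProb (v + d + e) μ ν t (v + d) (v - 1)) =
      v * ν * (((v + d + e).choose (v + d) * (v + d).choose v : ℕ) *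
        Real.exp (-(μ * t)) ^ e *
        (1 - Real.exp (-(μ * t)) - sumCdf μ ν t) ^ (d + 1) * sumCdf μ ν t ^ (v - 1)) := by
    rcases v with _ | v
    · simp
    · have h1 := Nat.choose_succ_right_eq (v + 1 + d) v
      rw [show v + 1 + d - v = d + 1 by omega] at h1
      have h1' := congrArg (Nat.cast : ℕ → ℝ) h1
      rw [if_neg (by omega), workersProb, Nat.add_sub_cancel,
        show v + 1 + d - v = d + 1 by omega, Nat.add_sub_cancel_left]
      push_cast at h1' ⊢
      linear_combination -h1' * (ν * (Nat.choose (v + 1 + d + e) (v + 1 + d)) *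
        Real.exp (-(μ * t)) ^ e *
        (1 - Real.exp (-(μ * t)) - sumCdf μ ν t) ^ (d + 1) * sumCdf μ ν t ^ v)
  rw [hcomp, hcomm]
  unfold workersProb
  simp only [Nat.add_sub_cancel_left, Pi.mul_apply, Pi.sub_apply]
  generalize Real.exp (-(μ * t)) = a
  generalize sumCdf μ ν t = c
  have hpow : ∀ (k : ℕ) (x : ℝ), (k : ℝ) * x ^ (k - 1) * x = k * x ^ k := by
    intro k x
    rcases k with _ | k
    · simp
    · rw [Nat.add_sub_cancel]; ring
  have he := hpow e a
  have hd := hpow d (1 - a - c)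
  push_cast
  generalize ((v + d + e).choose (v + d) : ℝ) = A
  generalize ((v + d).choose v : ℝ) = B
  linear_combination (-μ * A * B * (1 - a - c) ^ d * c ^ v) * he -
    (ν * A * B * a ^ e * c ^ v) * hd

/-- The number of workers that have finished is binomially distributed. -/
theorem sum_workersProb (n : ℕ) (μ ν t : ℝ) (v : ℕ) :
    ∑ u ∈ Finset.range (n + 1), workersProb n μ ν t u v =
      n.choose v * sumCdf μ ν t ^ v * (1 - sumCdf μ ν t) ^ (n - v) := by
  rcases lt_or_ge n v with h | h
  · rw [Nat.choose_eq_zero_of_lt h, Nat.cast_zero, zero_mul, zero_mul]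
    refine Finset.sum_eq_zero fun u hu => workersProb_of_lt ?_
    have := Finset.mem_range.1 hu
    omega
  obtain ⟨d, rfl⟩ := Nat.exists_eq_add_of_le h
  rw [add_assoc, Finset.sum_range_add,
    Finset.sum_eq_zero fun u hu => workersProb_of_lt (Finset.mem_range.1 hu), zero_add,
    Nat.add_sub_cancel_left]
  have hb : 1 - sumCdf μ ν t =
      (1 - Real.exp (-(μ * t)) - sumCdf μ ν t) + Real.exp (-(μ * t)) := by ring
  rw [hb, add_pow, Finset.mul_sum]
  refine Finset.sum_congr rfl fun j hj => ?_
  have hj : j ≤ d := by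
    have := Finset.mem_range.1 hj
    omega
  have h1 := Nat.choose_mul (n := v + d) (k := v + j) (s := v) (by omega)
  rw [Nat.add_sub_cancel_left, Nat.add_sub_cancel_left] at h1
  rw [workersProb, h1, Nat.add_sub_cancel_left, show v + d - (v + j) = d - j by omega]
  push_cast
  ring

/-! ### The hitting time of the coded chain -/

section CodedRate

variable {n k : ℕ} {μ₁ μ₂ ε : ℝ}

theorem codedRate_eq_zero_of_absorbing (x : Fin (n + 1) × Fin (k + 1))
    (hx : x ∈ {x : Fin (n + 1) × Fin (k + 1) | x.2 = Fin.last k})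
    (y : Fin (n + 1) × Fin (k + 1)) (hy : y ∉ {x : Fin (n + 1) × Fin (k + 1) | x.2 = Fin.last k}) :
    codedRate n k μ₁ μ₂ ε x y = 0 := by
  have hx' : (x.2 : ℕ) = k := by
    rw [show x.2 = Fin.last k from hx]; rfl
  have hy' : (y.2 : ℕ) ≠ k := fun h => hy (Fin.ext h)
  unfold codedRate
  dsimp only
  rw [if_neg (by omega), if_neg (by omega)]

/-- The candidate for the probability of the state `y` of the chain at time `t`. The value `0` on
the absorbing set `v = k` is a convention: there the chain stops counting the finished
communications, and the probabilities of the chain and of the workers differ. -/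
noncomputable def aliveProb (n k : ℕ) (μ ν t : ℝ) (y : Fin (n + 1) × Fin (k + 1)) : ℝ :=
  if y.2 = Fin.last k then 0 else workersProb n μ ν t y.1 y.2

theorem sum_ite_val_eq (N K a b : ℕ) (c : ℝ) :
    ∑ z : Fin N × Fin K, (if (z.1 : ℕ) = a ∧ (z.2 : ℕ) = b then c else 0) =
      if a < N ∧ b < K then c else 0 := by
  split_ifs with h
  · rw [Finset.sum_eq_single (⟨a, h.1⟩, ⟨b, h.2⟩)]
    · simp
    · rintro ⟨x, y⟩ - hne
      refine if_neg fun h' => hne ?_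
      exact Prod.ext (Fin.ext h'.1) (Fin.ext h'.2)
    · simp
  · refine Finset.sum_eq_zero fun z _ => if_neg fun h' => h ?_
    have h1 := z.1.isLt
    have h2 := z.2.isLt
    omega

/-- The total rate out of `(u, v)`. At the boundary `u = n` or `v = u` the missing transitions have
the coefficients `n - u = 0` and `u - v = 0`. -/
theorem sum_codedRate_from {u v : ℕ} (hu : u < n + 1) (hv : v < k + 1) (hvu : v ≤ u) (hvk : v < k) :
    ∑ z ∈ Finset.univ.erase ((⟨u, hu⟩, ⟨v, hv⟩) : Fin (n + 1) × Fin (k + 1)),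
      codedRate n k μ₁ μ₂ ε (⟨u, hu⟩, ⟨v, hv⟩) z =
    ((n : ℝ) - u) * μ₁ + ((u : ℝ) - v) * ((1 - ε) * μ₂) := by
  have hF : ∀ z : Fin (n + 1) × Fin (k + 1),
      codedRate n k μ₁ μ₂ ε (⟨u, hu⟩, ⟨v, hv⟩) z =
      (if (z.1 : ℕ) = u + 1 ∧ (z.2 : ℕ) = v then ((n : ℝ) - u) * μ₁ else 0) +
      (if (z.1 : ℕ) = u ∧ (z.2 : ℕ) = v + 1 then ((u : ℝ) - v) * ((1 - ε) * μ₂) else 0) := by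
    intro z
    have hz := z.1.isLt
    unfold codedRate
    dsimp only
    by_cases h1 : (z.1 : ℕ) = u + 1 ∧ (z.2 : ℕ) = v
    · rw [if_pos ⟨h1, hvu, by omega⟩, if_pos h1, if_neg (by omega), add_zero]
    · rw [if_neg (fun h => h1 h.1), if_neg h1, zero_add]
      by_cases h2 : (z.1 : ℕ) = u ∧ (z.2 : ℕ) = v + 1
      · rw [if_pos h2]
        rcases hvu.eq_or_lt with rfl | h
        · rw [if_neg (by omega)]; simp
        · rw [if_pos ⟨h2, by omega⟩, mul_assoc]
      · rw [if_neg (fun h => h2 h.1), if_neg h2]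
  rw [Finset.sum_erase _ (by rw [hF]; simp), Finset.sum_congr rfl fun z _ => hF z,
    Finset.sum_add_distrib, sum_ite_val_eq, sum_ite_val_eq,
    if_pos (show u < n + 1 ∧ v + 1 < k + 1 by omega)]
  congr 1
  -- for `u = n` the target `(n + 1, v)` does not exist, but the rate is `0`
  rcases (show u ≤ n by omega).eq_or_lt with rfl | h
  · rw [sub_self, zero_mul, ite_self]
  · rw [if_pos (show u + 1 < n + 1 ∧ v < k + 1 by omega)]

/-- The inflow into `(u, v)`. The predecessor `(u - 1, v)` with `v > u - 1` has no transition to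
`(u, v)`, which does not matter since its probability is `0`. -/
theorem sum_aliveProb_mul_codedRate {u v : ℕ} (hu : u < n + 1) (hv : v < k + 1)
    (hvu : v ≤ u) (hvk : v < k) (ν t : ℝ) :
    ∑ z ∈ Finset.univ.erase ((⟨u, hu⟩, ⟨v, hv⟩) : Fin (n + 1) × Fin (k + 1)),
      aliveProb n k μ₁ ν t z * codedRate n k μ₁ μ₂ ε z (⟨u, hu⟩, ⟨v, hv⟩) =
    (if u = 0 then 0 else ((n : ℝ) - (u - 1 : ℕ)) * μ₁ * workersProb n μ₁ ν t (u - 1) v) +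
    (if v = 0 then 0 else
      ((u : ℝ) - (v - 1 : ℕ)) * ((1 - ε) * μ₂) * workersProb n μ₁ ν t u (v - 1)) := by
  have hF : ∀ z : Fin (n + 1) × Fin (k + 1),
      aliveProb n k μ₁ ν t z * codedRate n k μ₁ μ₂ ε z (⟨u, hu⟩, ⟨v, hv⟩) =
      (if u = 0 then 0 else if (z.1 : ℕ) = u - 1 ∧ (z.2 : ℕ) = v then
        ((n : ℝ) - (u - 1 : ℕ)) * μ₁ * workersProb n μ₁ ν t (u - 1) v else 0) +
      (if v = 0 then 0 else if (z.1 : ℕ) = u ∧ (z.2 : ℕ) = v - 1 then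
        ((u : ℝ) - (v - 1 : ℕ)) * ((1 - ε) * μ₂) * workersProb n μ₁ ν t u (v - 1) else 0) := by
    rintro ⟨⟨u', hu'⟩, ⟨v', hv'⟩⟩
    have hal : (⟨v', hv'⟩ : Fin (k + 1)) = Fin.last k ↔ v' = k := Fin.ext_iff
    unfold codedRate aliveProb
    dsimp only
    simp only [hal]
    by_cases h1 : u = u' + 1 ∧ v = v'
    · obtain ⟨rfl, rfl⟩ := h1
      have h2 : (if v = 0 then (0 : ℝ) else if u' = u' + 1 ∧ v = v - 1 then
          (((u' + 1 : ℕ) : ℝ) - (v - 1 : ℕ)) * ((1 - ε) * μ₂) *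
            workersProb n μ₁ ν t (u' + 1) (v - 1) else 0) = 0 := by
        rw [if_neg (show ¬(u' = u' + 1 ∧ v = v - 1) by omega), ite_self]
      rw [h2, add_zero, if_neg (show ¬v = k by omega), if_neg (Nat.succ_ne_zero u'),
        Nat.add_sub_cancel, if_pos (show u' = u' ∧ v = v from ⟨rfl, rfl⟩)]
      rcases lt_or_ge u' v with h | h
      · rw [workersProb_of_lt h, zero_mul, mul_zero]
      · rw [if_pos ⟨⟨rfl, rfl⟩, h, by omega⟩]; ring
    · have h2 : (if u = 0 then (0 : ℝ) else if u' = u - 1 ∧ v' = v then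
          ((n : ℝ) - (u - 1 : ℕ)) * μ₁ * workersProb n μ₁ ν t (u - 1) v else 0) = 0 := by
        split_ifs <;> first | rfl | omega
      have h5 : ¬((u = u' + 1 ∧ v = v') ∧ v' ≤ u' ∧ u' < n) := fun h => h1 h.1
      rw [h2, zero_add, if_neg h5]
      by_cases h3 : u = u' ∧ v = v' + 1
      · obtain ⟨rfl, rfl⟩ := h3
        rw [if_neg (show ¬v' = k by omega), if_neg (Nat.succ_ne_zero v'), Nat.add_sub_cancel,
          if_pos (show u = u ∧ v' = v' from ⟨rfl, rfl⟩), if_pos ⟨⟨rfl, rfl⟩, by omega⟩]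
        ring
      · have h4 : (if v = 0 then (0 : ℝ) else if u' = u ∧ v' = v - 1 then
          ((u : ℝ) - (v - 1 : ℕ)) * ((1 - ε) * μ₂) * workersProb n μ₁ ν t u (v - 1) else 0)
            = 0 := by
          split_ifs <;> first | rfl | omega
        have h6 : ¬((u = u' ∧ v = v' + 1) ∧ v' < min u' k) := fun h => h3 h.1
        rw [h4, if_neg h6, mul_zero]
  have hself : codedRate n k μ₁ μ₂ ε (⟨u, hu⟩, ⟨v, hv⟩) (⟨u, hu⟩, ⟨v, hv⟩) = 0 := by
    unfold codedRate
    dsimp only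
    rw [if_neg (by omega), if_neg (by omega)]
  rw [Finset.sum_erase _ (by rw [hself, mul_zero]),
    Finset.sum_congr rfl fun z _ => hF z, Finset.sum_add_distrib]
  congr 1
  · split_ifs with h
    · simp
    · rw [sum_ite_val_eq, if_pos (show u - 1 < n + 1 ∧ v < k + 1 by omega)]
  · split_ifs with h
    · simp
    · rw [sum_ite_val_eq, if_pos (show u < n + 1 ∧ v - 1 < k + 1 by omega)]

/-- `aliveProb` solves the forward equation of the chain off the absorbing set. -/
theorem aliveProb_forward_equation (t : ℝ) {y : Fin (n + 1) × Fin (k + 1)}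
    (hy : y.2 ≠ Fin.last k) :
    HasDerivAt (fun t => aliveProb n k μ₁ ((1 - ε) * μ₂) t y)
      (∑ z, aliveProb n k μ₁ ((1 - ε) * μ₂) t z *
        generator (codedRate n k μ₁ μ₂ ε) z y) t := by
  obtain ⟨⟨u, hu⟩, ⟨v, hv⟩⟩ := y
  have hvk : v < k := by
    have : v ≠ k := fun h => hy (Fin.ext h)
    omega
  have hsplit : ∑ z, aliveProb n k μ₁ ((1 - ε) * μ₂) t z *
        generator (codedRate n k μ₁ μ₂ ε) z (⟨u, hu⟩, ⟨v, hv⟩) =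
      -(workersProb n μ₁ ((1 - ε) * μ₂) t u v *
        ∑ z ∈ Finset.univ.erase ((⟨u, hu⟩, ⟨v, hv⟩) : Fin (n + 1) × Fin (k + 1)),
          codedRate n k μ₁ μ₂ ε (⟨u, hu⟩, ⟨v, hv⟩) z) +
      ∑ z ∈ Finset.univ.erase ((⟨u, hu⟩, ⟨v, hv⟩) : Fin (n + 1) × Fin (k + 1)),
        aliveProb n k μ₁ ((1 - ε) * μ₂) t z * codedRate n k μ₁ μ₂ ε z (⟨u, hu⟩, ⟨v, hv⟩) := by
    rw [← Finset.add_sum_erase _ _ (Finset.mem_univ (⟨u, hu⟩, ⟨v, hv⟩))]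
    congr 1
    · simp only [generator, if_true, aliveProb, if_neg hy]
      ring
    · refine Finset.sum_congr rfl fun z hz => ?_
      simp only [generator, if_neg (Finset.ne_of_mem_erase hz)]
  have hfun : (fun t => aliveProb n k μ₁ ((1 - ε) * μ₂) t (⟨u, hu⟩, ⟨v, hv⟩)) =
      fun t => workersProb n μ₁ ((1 - ε) * μ₂) t u v := by
    ext t
    simp only [aliveProb, if_neg hy]
  rw [hsplit, hfun]
  rcases lt_or_ge u v with h | hvu
  · -- the states with more communicated than computed results are never entered
    simp only [workersProb_of_lt h, zero_mul, neg_zero, zero_add]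
    rw [Finset.sum_eq_zero]
    · exact hasDerivAt_const t 0
    · rintro ⟨⟨u', hu'⟩, ⟨v', hv'⟩⟩ -
      have : codedRate n k μ₁ μ₂ ε (⟨u', hu'⟩, ⟨v', hv'⟩) (⟨u, hu⟩, ⟨v, hv⟩) = 0 := by
        unfold codedRate
        dsimp only
        rw [if_neg (by omega), if_neg (by omega)]
      rw [this, mul_zero]
  · rw [sum_codedRate_from hu hv hvu hvk, sum_aliveProb_mul_codedRate hu hv hvu hvk]
    refine (hasDerivAt_workersProb μ₁ ((1 - ε) * μ₂) t (by omega : u ≤ n) hvu).congr_deriv ?_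
    ring

/-- The chain is outside the absorbing set with the probability that fewer than `k` workers have
finished. -/
theorem sum_aliveProb (n k : ℕ) (μ ν t : ℝ) :
    ∑ y, aliveProb n k μ ν t y = ∑ v ∈ Finset.range k,
      n.choose v * sumCdf μ ν t ^ v * (1 - sumCdf μ ν t) ^ (n - v) := by
  rw [Fintype.sum_prod_type, Finset.sum_comm, Fin.sum_univ_castSucc]
  have hlast : ∑ u, aliveProb n k μ ν t (u, Fin.last k) = 0 := by simp [aliveProb]
  rw [hlast, add_zero, Finset.sum_range]
  refine Finset.sum_congr rfl fun v _ => ?_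
  rw [← sum_workersProb, Finset.sum_range]
  refine Finset.sum_congr rfl fun u _ => ?_
  simp [aliveProb, (Fin.castSucc_lt_last v).ne]

/-- The distribution function of the hitting time is a binomial tail: the chain has reached `v = k`
by time `t` with the probability that at least `k` of the workers have finished. -/
theorem measure_hittingTime_coded_le
    {Ω : Type*} [MeasurableSpace Ω] {Pr : Measure Ω}
    {C : ℝ≥0 → Ω → Fin (n + 1) × Fin (k + 1)}
    (hC : IsMarkovChainFrom (codedRate n k μ₁ μ₂ ε) (0, 0) C Pr) (t : ℝ≥0) :
    Pr {ω | hittingTime C {x | x.2 = Fin.last k} ω ≤ t} =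
      ENNReal.ofReal (1 - ∑ v ∈ Finset.range k, n.choose v *
        sumCdf μ₁ ((1 - ε) * μ₂) t ^ v * (1 - sumCdf μ₁ ((1 - ε) * μ₂) t) ^ (n - v)) := by
  rw [hC.measure_hittingTime_le_eq codedRate_eq_zero_of_absorbing
    (aliveProb n k μ₁ ((1 - ε) * μ₂)) ?_ ?_ ?_ ?_ t, sum_aliveProb]
  · intro t y hy
    exact if_pos hy
  · intro y hy t _
    exact (aliveProb_forward_equation t hy).continuousAt.continuousWithinAt
  · intro t _ y hy
    exact (aliveProb_forward_equation t hy).hasDerivWithinAt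
  · intro y hy
    have hy' : y.2 ≠ Fin.last k := hy
    rw [aliveProb, if_neg hy', workersProb_zero, Matrix.one_apply]
    refine if_congr ?_ rfl rfl
    rw [Prod.ext_iff, Fin.ext_iff, Fin.ext_iff, eq_comm (b := (y.1 : ℕ)), eq_comm (b := (y.2 : ℕ))]
    rfl

end CodedRate

/-! ### Order statistics and independence -/

/-- A variable is at most `t` as the `k`-th smallest exactly if at least `k` of them are. -/
theorem kthMin_le_iff {n : ℕ} (a : Fin n → ℝ) (k : ℕ) (hk : 1 ≤ k ∧ k ≤ n) (t : ℝ) :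
    kthMin a k hk ≤ t ↔ k ≤ (Finset.univ.filter fun i => a i ≤ t).card := by
  have h := Tuple.lt_card_le_iff_apply_le_of_monotone (j := ⟨k - 1, by omega⟩) (a := t)
    (Tuple.monotone_sort a)
  have hcard : (Finset.univ.filter fun i => (a ∘ Tuple.sort a) i ≤ t).card =
      (Finset.univ.filter fun i => a i ≤ t).card := by
    refine Finset.card_bij (fun i _ => Tuple.sort a i) ?_ ?_ ?_
    · intro i hi; simpa using hi
    · intro i _ j _ hij; exact (Tuple.sort a).injective hij
    · intro i hi
      exact ⟨(Tuple.sort a).symm i, by simpa using hi, by simp⟩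
  rw [hcard] at h
  unfold kthMin
  refine Iff.trans h.symm ?_
  dsimp only
  omega

theorem abs_kthMin_le {n : ℕ} (a : Fin n → ℝ) (k : ℕ) (hk : 1 ≤ k ∧ k ≤ n) :
    |kthMin a k hk| ≤ ∑ i, |a i| :=
  Finset.single_le_sum (f := fun i => |a i|) (fun i _ => abs_nonneg (a i)) (Finset.mem_univ _)

section Independence

variable {Ω ι : Type*} [MeasurableSpace Ω] {Pr : Measure Ω}

/-- Mutually independent variables can be grouped: the resulting families of variables are mutually
independent. -/
theorem ProbabilityTheory.iIndepFun.curry {κ : ι → Type*} {𝓧 : (i : ι) → κ i → Type*}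
    [∀ i j, MeasurableSpace (𝓧 i j)] [IsProbabilityMeasure Pr]
    {X : (i : ι) → (j : κ i) → Ω → 𝓧 i j} (hX : ∀ i j, Measurable (X i j))
    (h : iIndepFun (fun (p : Σ i, κ i) => X p.1 p.2) Pr) :
    iIndepFun (fun i ω j => X i j ω) Pr := by
  have hX' : ∀ i, Measurable fun ω j => X i j ω := fun i => measurable_pi_iff.2 (hX i)
  rw [iIndepFun_iff_map_fun_eq_infinitePi_map hX']
  have h1 := (iIndepFun_iff_map_fun_eq_infinitePi_map (fun p : Σ i, κ i => hX p.1 p.2)).1 h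
  have h2 : ∀ i, Pr.map (fun ω j => X i j ω) = Measure.infinitePi fun j => Pr.map (X i j) := by
    intro i
    have h3 : iIndepFun (fun j => X i j) Pr :=
      h.precomp (g := fun j => (⟨i, j⟩ : Σ i, κ i)) sigma_mk_injective
    exact (iIndepFun_iff_map_fun_eq_infinitePi_map (hX i)).1 h3
  have : ∀ i j, IsProbabilityMeasure (Pr.map (X i j)) := fun i j =>
    Measure.isProbabilityMeasure_map (hX i j).aemeasurable
  simp_rw [h2]
  rw [← Measure.infinitePi_map_piCurry (fun i j => Pr.map (X i j)), ← h1,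
    Measure.map_map (by fun_prop) (measurable_pi_iff.2 fun p => hX p.1 p.2)]
  rfl

/-- Subfamilies of mutually independent variables with disjoint (possibly infinite) index sets are
independent. -/
theorem ProbabilityTheory.iIndepFun.indepFun_of_disjoint {𝓧 : ι → Type*}
    [∀ i, MeasurableSpace (𝓧 i)] {f : (i : ι) → Ω → 𝓧 i} (hf : ∀ i, Measurable (f i))
    (h : iIndepFun f Pr) {S T : Set ι}
    (hST : Disjoint S T) :
    IndepFun (fun ω (i : S) => f i ω) (fun ω (i : T) => f i ω) Pr := by
  have h1 := indep_iSup_of_disjoint (fun i => (hf i).comap_le) h.iIndep hST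
  have h2 : ∀ S : Set ι, MeasurableSpace.comap (fun ω (i : S) => f i ω) MeasurableSpace.pi =
      ⨆ i ∈ S, MeasurableSpace.comap (f i) inferInstance := by
    intro S
    rw [MeasurableSpace.pi, MeasurableSpace.comap_iSup, iSup_subtype']
    simp_rw [MeasurableSpace.comap_comp]
    rfl
  rw [IndepFun_iff_Indep, h2, h2]
  exact h1

end Independence

/-- The number of those among independent events of the same probability `p` that occur is
binomially distributed. -/
theorem measure_le_card_filter {n : ℕ} {Ω : Type*} [MeasurableSpace Ω] {Pr : Measure Ω}
    [IsProbabilityMeasure Pr] {Z : Fin n → Ω → ℝ} (hZ : ∀ i, Measurable (Z i))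
    (hind : iIndepFun Z Pr) {t p : ℝ} (hp : ∀ i, Pr.real {ω | Z i ω ≤ t} = p) (k : ℕ) :
    Pr.real {ω | k ≤ (Finset.univ.filter fun i => Z i ω ≤ t).card} =
      1 - ∑ v ∈ Finset.range k, n.choose v * p ^ v * (1 - p) ^ (n - v) := by
  classical
  let D : Ω → Finset (Fin n) := fun ω => Finset.univ.filter fun i => Z i ω ≤ t
  have hset : ∀ s : Finset (Fin n), {ω | D ω = s} =
      ⋂ i, Z i ⁻¹' (if i ∈ s then Iic t else Ioi t) := by
    intro s
    ext ω
    simp only [D, mem_ofPred_eq, Finset.ext_iff, Finset.mem_filter, Finset.mem_univ, true_and,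
      mem_iInter, mem_preimage]
    refine forall_congr' fun i => ?_
    by_cases hi : i ∈ s <;> simp [hi]
  have hms : ∀ (s : Finset (Fin n)) (i : Fin n),
      MeasurableSet (if i ∈ s then Iic t else Ioi t) := by
    intro s i
    split_ifs
    exacts [measurableSet_Iic, measurableSet_Ioi]
  have hD : ∀ s : Finset (Fin n), MeasurableSet {ω | D ω = s} := by
    intro s
    rw [hset]
    exact MeasurableSet.iInter fun i => hZ i (hms s i)
  have hone : ∀ i, Pr.real {ω | t < Z i ω} = 1 - p := by
    intro i
    have h1 := probReal_compl_eq_one_sub (μ := Pr)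
      (measurableSet_le (hZ i) (measurable_const (a := t)))
    rw [hp i] at h1
    rw [← h1]
    congr 1
    ext ω; simp
  have hprob : ∀ s : Finset (Fin n), Pr.real {ω | D ω = s} =
      p ^ s.card * (1 - p) ^ (n - s.card) := by
    intro s
    rw [hset, measureReal_def, hind.meas_iInter fun i => ⟨_, hms s i, rfl⟩, ENNReal.toReal_prod]
    have h1 : ∀ i, (Pr (Z i ⁻¹' (if i ∈ s then Iic t else Ioi t))).toReal =
        if i ∈ s then p else 1 - p := by
      intro i
      split_ifs
      · exact hp i
      · exact hone i
    simp_rw [h1]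
    rw [Finset.prod_ite, Finset.prod_const, Finset.prod_const, Finset.filter_mem_eq_inter,
      Finset.univ_inter, Finset.filter_not, Finset.filter_mem_eq_inter, Finset.univ_inter,
      Finset.card_univ_sdiff, Fintype.card_fin]
  have hunion : {ω | (D ω).card < k} =
      ⋃ s ∈ (Finset.univ.filter fun s : Finset (Fin n) => s.card < k), {ω | D ω = s} := by
    ext ω; simp
  have hlt : Pr.real {ω | (D ω).card < k} =
      ∑ v ∈ Finset.range k, n.choose v * p ^ v * (1 - p) ^ (n - v) := by
    rw [hunion, measureReal_biUnion_finset]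
    · rw [Finset.sum_congr rfl fun s _ => hprob s]
      rw [← Finset.sum_fiberwise_of_maps_to (t := Finset.range k) (g := Finset.card)]
      · refine Finset.sum_congr rfl fun v hv => ?_
        have hv := Finset.mem_range.1 hv
        have h2 : ((Finset.univ.filter fun s : Finset (Fin n) => s.card < k).filter
            fun s => s.card = v) = Finset.powersetCard v Finset.univ := by
          ext s
          simp only [Finset.mem_filter, Finset.mem_univ, true_and, Finset.mem_powersetCard,
            Finset.subset_univ]
          omega
        rw [h2, Finset.sum_congr rfl (g := fun _ => p ^ v * (1 - p) ^ (n - v)),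
          Finset.sum_const, Finset.card_powersetCard, Finset.card_fin, nsmul_eq_mul, mul_assoc]
        intro s hs
        rw [(Finset.mem_powersetCard.1 hs).2]
      · intro s hs
        simpa using hs
    · intro s _ s' _ hss
      exact Set.disjoint_left.2 fun ω hω hω' => hss (hω.symm.trans hω')
    · exact fun s _ => hD s
  have hm : MeasurableSet {ω | (D ω).card < k} := by
    rw [hunion]
    exact Finset.measurableSet_biUnion _ fun s _ => hD s
  rw [← hlt, ← probReal_compl_eq_one_sub hm]
  congr 1
  ext ω; simp [D]

/-! ### Exponential distributions -/

theorem expMeasure_eq_withDensity (r : ℝ) :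
    expMeasure r = (volume.restrict (Ici 0)).withDensity
      fun x => ENNReal.ofReal (r * Real.exp (-(r * x))) := by
  rw [← withDensity_indicator measurableSet_Ici]
  change volume.withDensity (exponentialPDF r) = _
  congr 1
  ext x
  rw [exponentialPDF_eq]
  by_cases hx : 0 ≤ x
  · rw [if_pos hx, indicator_of_mem (by exact hx)]
  · rw [if_neg hx, indicator_of_notMem (by exact hx), ENNReal.ofReal_zero]

theorem integral_expMeasure {F : Type*} [NormedAddCommGroup F] [NormedSpace ℝ F] {r : ℝ}
    (hr : 0 < r) (f : ℝ → F) :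
    ∫ x, f x ∂expMeasure r = ∫ x in Ici 0, (r * Real.exp (-(r * x))) • f x := by
  rw [expMeasure_eq_withDensity, integral_withDensity_eq_integral_toReal_smul (by fun_prop)
    (by simp)]
  refine integral_congr_ae (Eventually.of_forall fun x => ?_)
  dsimp only
  rw [ENNReal.toReal_ofReal (by positivity)]

theorem integrable_id_expMeasure {r : ℝ} (hr : 0 < r) : Integrable (fun x => x) (expMeasure r) := by
  rw [expMeasure_eq_withDensity, integrable_withDensity_iff (by fun_prop) (by simp)]
  change IntegrableOn _ (Ici (0 : ℝ)) volume
  rw [integrableOn_Ici_iff_integrableOn_Ioi]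
  have h := (integrableOn_rpow_mul_exp_neg_mul_rpow (p := 1) (s := 1) (b := r) (by norm_num)
    one_pos hr).const_mul r
  refine h.congr (Eventually.of_forall fun x => ?_)
  dsimp only
  rw [ENNReal.toReal_ofReal (by positivity), Real.rpow_one, neg_mul]
  ring

theorem charFun_expMeasure {r : ℝ} (hr : 0 < r) (u : ℝ) :
    charFun (expMeasure r) u = r / (r - u * Complex.I) := by
  have hre : ((u * Complex.I - r : ℂ)).re < 0 := by simpa using hr
  have hne : (r - u * Complex.I : ℂ) ≠ 0 := by
    intro h
    have := congrArg Complex.re h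
    simp at this
    exact hr.ne' this
  have hne' : (u * Complex.I - r : ℂ) ≠ 0 := by
    intro h
    rw [h] at hre
    simp at hre
  rw [charFun_apply_real, integral_expMeasure hr, integral_Ici_eq_integral_Ioi]
  have h1 : ∀ x : ℝ, (r * Real.exp (-(r * x))) • Complex.exp (u * x * Complex.I) =
      r * Complex.exp ((u * Complex.I - r) * x) := by
    intro x
    rw [Complex.real_smul]
    push_cast
    rw [mul_assoc, ← Complex.exp_add]
    congr 2
    ring
  simp_rw [h1]
  rw [integral_const_mul, integral_exp_mul_complex_Ioi hre]
  simp only [Complex.ofReal_zero, mul_zero, Complex.exp_zero]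
  field_simp
  ring

theorem measurable_sum_range :
    Measurable fun p : ℕ × (ℕ → ℝ) => ∑ j ∈ Finset.range p.1, p.2 j :=
  measurable_from_prod_countable_right fun l =>
    Finset.measurable_fun_sum (Finset.range l) fun j _ => measurable_pi_apply j

/-- A sum of a geometric number of independent exponential variables is exponential: with `φ` the
characteristic function of the summands, that of the sum is
`∑ l, (1 - ε) * ε ^ l * φ ^ (l + 1) = (1 - ε) * φ / (1 - ε * φ)`. -/
theorem map_geometric_sum {Ω : Type*} [MeasurableSpace Ω] {Pr : Measure Ω}
    [IsProbabilityMeasure Pr] {N : Ω → ℕ} {Y : ℕ → Ω → ℝ} {μ ε : ℝ} (hμ : 0 < μ) (hε₀ : 0 ≤ ε)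
    (hε₁ : ε < 1) (hN : Measurable N) (hY : ∀ j, Measurable (Y j))
    (lawN : ∀ l : ℕ, 1 ≤ l → Pr {ω | N ω = l} = ENNReal.ofReal ((1 - ε) * ε ^ (l - 1)))
    (lawY : ∀ j, Pr.map (Y j) = expMeasure μ) (hind : IndepFun N (fun ω j => Y j ω) Pr)
    (hindY : iIndepFun Y Pr) :
    Pr.map (fun ω => ∑ j ∈ Finset.range (N ω), Y j ω) = expMeasure ((1 - ε) * μ) := by
  have hr : 0 < (1 - ε) * μ := mul_pos (by linarith) hμ
  have := isProbabilityMeasure_expMeasure hr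
  have hW := measurable_sum_range
  have hY' : Measurable fun ω j => Y j ω := measurable_pi_iff.2 hY
  have hNY := hN.prodMk hY'
  have hS : Measurable fun ω => ∑ j ∈ Finset.range (N ω), Y j ω := hW.comp hNY
  have := Measure.isProbabilityMeasure_map hS.aemeasurable (μ := Pr)
  have := Measure.isProbabilityMeasure_map hN.aemeasurable (μ := Pr)
  have := Measure.isProbabilityMeasure_map hY'.aemeasurable (μ := Pr)
  refine Measure.ext_of_charFun (funext fun u => ?_)
  set φ : ℂ := charFun (expMeasure μ) u with hφ
  have hφ1 : ‖φ‖ ≤ 1 := by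
    have := isProbabilityMeasure_expMeasure hμ
    exact norm_charFun_le_one u
  -- the law of the number of summands
  have hp : ∀ l : ℕ, (Pr.map N).real {l + 1} = (1 - ε) * ε ^ l := by
    intro l
    rw [map_measureReal_apply hN (measurableSet_singleton _), measureReal_def]
    change (Pr {ω | N ω = l + 1}).toReal = _
    rw [lawN (l + 1) (by omega), Nat.add_sub_cancel,
      ENNReal.toReal_ofReal (mul_nonneg (by linarith) (pow_nonneg hε₀ l))]
  have hgeo : HasSum (fun l : ℕ => (1 - ε) * ε ^ l) 1 := by
    have := (hasSum_geometric_of_lt_one hε₀ hε₁).mul_left (1 - ε)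
    rwa [mul_inv_cancel₀ (by linarith)] at this
  -- the law is only prescribed on `l ≥ 1`, where it has total mass `1`
  have hp0 : (Pr.map N).real {0} = 0 := by
    have h1 := integral_countable (μ := Pr.map N) (integrable_const (1 : ℝ))
    have h2 : Summable fun l : ℕ => (Pr.map N).real {l} • (1 : ℝ) := by
      rw [← summable_nat_add_iff 1]
      simpa [hp] using hgeo.summable
    rw [h2.tsum_eq_zero_add] at h1
    simp only [hp, smul_eq_mul, mul_one, hgeo.tsum_eq] at h1
    simp at h1
    exact h1
  -- the characteristic function, given that there are `l` summands
  have hcond : ∀ l : ℕ, ∫ y : ℕ → ℝ, Complex.exp (u * (∑ j ∈ Finset.range l, y j : ℝ) * Complex.I)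
      ∂(Pr.map fun ω j => Y j ω) = φ ^ l := by
    intro l
    rw [integral_map hY'.aemeasurable (by fun_prop)]
    have h1 := iIndepFun.charFun_map_fun_finsetSum_eq_prod (s := Finset.range l)
      (fun j _ => (hY j).aemeasurable) (hindY.restrict _)
    have h2 := congrFun h1 u
    rw [charFun_apply_real, integral_map (by fun_prop) (by fun_prop)] at h2
    rw [h2]
    simp [lawY, hφ]
  have hint : charFun (Pr.map fun ω => ∑ j ∈ Finset.range (N ω), Y j ω) u =
      ∫ l, φ ^ l ∂(Pr.map N) := by
    have hm : Measurable fun p : ℕ × (ℕ → ℝ) =>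
        Complex.exp (u * (∑ j ∈ Finset.range p.1, p.2 j : ℝ) * Complex.I) := by fun_prop
    rw [charFun_apply_real, integral_map hS.aemeasurable (by fun_prop)]
    have h1 := (indepFun_iff_map_prod_eq_prod_map_map hN.aemeasurable hY'.aemeasurable).1 hind
    have h2 := integral_map hNY.aemeasurable (μ := Pr) (f := fun p : ℕ × (ℕ → ℝ) =>
        Complex.exp (u * (∑ j ∈ Finset.range p.1, p.2 j : ℝ) * Complex.I))
        hm.aestronglyMeasurable
    rw [← h2, h1, integral_prod]
    · simp_rw [hcond]
    · refine Integrable.of_bound hm.aestronglyMeasurable 1 (Eventually.of_forall fun p => ?_)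
      rw [← Complex.ofReal_mul, Complex.norm_exp_ofReal_mul_I]
  have hintble : Integrable (fun l : ℕ => φ ^ l) (Pr.map N) := by
    refine Integrable.of_bound (by fun_prop) 1 (Eventually.of_forall fun l => ?_)
    rw [norm_pow]
    exact pow_le_one₀ (norm_nonneg _) hφ1
  have hεφ : ‖(ε : ℂ) * φ‖ < 1 := by
    rw [norm_mul, Complex.norm_of_nonneg hε₀]
    nlinarith [norm_nonneg φ]
  have hgeoφ : HasSum (fun l : ℕ => (Pr.map N).real {l + 1} • φ ^ (l + 1))
      ((1 - ε) * φ * (1 - ε * φ)⁻¹) := by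
    have h1 := (hasSum_geometric_of_norm_lt_one hεφ).mul_left ((1 - ε) * φ)
    refine h1.congr_fun fun l => ?_
    rw [hp, Complex.real_smul]
    push_cast
    ring
  have hsum : Summable fun l : ℕ => (Pr.map N).real {l} • φ ^ l :=
    (summable_nat_add_iff 1).1 hgeoφ.summable
  rw [hint, integral_countable hintble, hsum.tsum_eq_zero_add, hp0, zero_smul, zero_add,
    hgeoφ.tsum_eq, charFun_expMeasure hr]
  have hne : ∀ s : ℝ, 0 < s → (s - u * Complex.I : ℂ) ≠ 0 := by
    intro s hs h
    have := congrArg Complex.re h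
    simp at this
    exact hs.ne' this
  have hne1 := hne μ hμ
  have hne2 := hne _ hr
  have hne3 : (1 - ε * φ : ℂ) ≠ 0 := by
    intro h
    rw [← sub_eq_zero.1 h, norm_one] at hεφ
    exact lt_irrefl _ hεφ
  rw [← div_eq_mul_inv, div_eq_div_iff hne3 hne2]
  have hφ2 : φ * (μ - u * Complex.I) = μ := by
    rw [hφ, charFun_expMeasure hμ, div_mul_cancel₀ _ hne1]
  push_cast
  linear_combination (1 - (ε : ℂ)) * hφ2

/-- The distribution function of the sum of two independent exponential variables. -/
theorem measureReal_add_le {Ω : Type*} [MeasurableSpace Ω] {Pr : Measure Ω}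
    [IsProbabilityMeasure Pr] {X S : Ω → ℝ} {μ ν : ℝ} (hμ : 0 < μ) (hν : 0 < ν)
    (hX : Measurable X) (hS : Measurable S) (lawX : Pr.map X = expMeasure μ)
    (lawS : Pr.map S = expMeasure ν) (hind : IndepFun X S Pr) {t : ℝ} (ht : 0 ≤ t) :
    Pr.real {ω | X ω + S ω ≤ t} = sumCdf μ ν t := by
  have := isProbabilityMeasure_expMeasure hμ
  have := isProbabilityMeasure_expMeasure hν
  have hs : MeasurableSet {p : ℝ × ℝ | p.1 + p.2 ≤ t} :=
    measurableSet_le (by fun_prop) (by fun_prop)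
  have h1 : Pr.real {ω | X ω + S ω ≤ t} =
      ((expMeasure μ).prod (expMeasure ν)).real {p : ℝ × ℝ | p.1 + p.2 ≤ t} := by
    rw [← lawX, ← lawS, ← (indepFun_iff_map_prod_eq_prod_map_map hX.aemeasurable
      hS.aemeasurable).1 hind, map_measureReal_apply (hX.prodMk hS) hs]
    rfl
  have h2 : ∀ y, (expMeasure μ).real ((fun x => (x, y)) ⁻¹' {p : ℝ × ℝ | p.1 + p.2 ≤ t}) =
      if y ≤ t then 1 - Real.exp (-(μ * (t - y))) else 0 := by
    intro y
    have h3 : (fun x => (x, y)) ⁻¹' {p : ℝ × ℝ | p.1 + p.2 ≤ t} = Iic (t - y) := by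
      ext x; simp [le_sub_iff_add_le]
    rw [h3, ← cdf_eq_real, cdf_expMeasure_eq hμ]
    simp
  have h3 : ((expMeasure μ).prod (expMeasure ν)).real {p : ℝ × ℝ | p.1 + p.2 ≤ t} =
      ∫ y, (expMeasure μ).real ((fun x => (x, y)) ⁻¹' {p : ℝ × ℝ | p.1 + p.2 ≤ t})
        ∂(expMeasure ν) := by
    rw [measureReal_def, Measure.prod_apply_symm hs]
    simp only [measureReal_def]
    rw [integral_toReal]
    · exact (measurable_measure_prodMk_right hs).aemeasurable
    · exact Eventually.of_forall fun y => measure_lt_top _ _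
  rw [h1, h3, integral_expMeasure hν]
  have h4 : ∀ y, (ν * Real.exp (-(ν * y))) •
      (expMeasure μ).real ((fun x => (x, y)) ⁻¹' {p : ℝ × ℝ | p.1 + p.2 ≤ t}) =
      (Iic t).indicator (fun s => ν * Real.exp (-(ν * s)) * (1 - Real.exp (-(μ * (t - s))))) y := by
    intro y
    rw [h2]
    by_cases hy : y ≤ t
    · rw [if_pos hy, indicator_of_mem (by exact hy), smul_eq_mul]
    · rw [if_neg hy, indicator_of_notMem (by exact hy), smul_zero]
  simp_rw [h4]
  rw [setIntegral_indicator measurableSet_Iic, Ici_inter_Iic, integral_Icc_eq_integral_Ioc,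
    ← intervalIntegral.integral_of_le ht, sumCdf]

/-! ### The run-time of the coded system -/

namespace IsCodedSystem

variable {n m k : ℕ} {μ₁ μ₂ ε : ℝ} {Ω : Type*} [MeasurableSpace Ω] {Pr : Measure Ω}
  {X : Fin n → Ω → ℝ} {N : Fin n → Fin (m / k) → Ω → ℕ}
  {Y : Fin n → Fin (m / k) → ℕ → Ω → ℝ}

theorem measurable_systemVars (h : IsCodedSystem m k μ₁ μ₂ ε Pr X N Y) (x) :
    Measurable (systemVars X N Y x) := by
  rcases x with i | ⟨i, r⟩ | ⟨i, r, j⟩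
  · exact h.measurable_X i
  · exact measurable_from_top.comp (h.measurable_N i r)
  · exact h.measurable_Y i r j

theorem measurable_commTime (h : IsCodedSystem m k μ₁ μ₂ ε Pr X N Y) (i : Fin n) :
    Measurable (commTime N Y i) := by
  refine Finset.measurable_fun_sum _ fun r _ => ?_
  exact measurable_sum_range.comp
    ((h.measurable_N i r).prodMk (measurable_pi_iff.2 fun j => h.measurable_Y i r j))

theorem measurable_completionTime (h : IsCodedSystem m k μ₁ μ₂ ε Pr X N Y) (i : Fin n) :
    Measurable fun ω => X i ω + commTime N Y i ω :=
  (h.measurable_X i).add (h.measurable_commTime i)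

theorem indepFun_commTime (h : IsCodedSystem m k μ₁ μ₂ ε Pr X N Y) (i : Fin n) :
    IndepFun (X i) (commTime N Y i) Pr := by
  have h1 := iIndepFun.indepFun_of_disjoint h.measurable_systemVars h.indep
    (disjoint_compl_right (a := {Sum.inl i}))
  have hφ : Measurable fun f : ({Sum.inl i} : Set (Fin n ⊕ (Fin n × Fin (m / k)) ⊕
      (Fin n × Fin (m / k) × ℕ))) → ℝ => f ⟨Sum.inl i, rfl⟩ := measurable_pi_apply _
  have hψ : Measurable fun f : (({Sum.inl i} : Set (Fin n ⊕ (Fin n × Fin (m / k)) ⊕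
      (Fin n × Fin (m / k) × ℕ)))ᶜ : Set _) → ℝ =>
      ∑ r : Fin (m / k), ∑ j ∈ Finset.range ⌊f ⟨Sum.inr (Sum.inl (i, r)), by simp⟩⌋₊,
        f ⟨Sum.inr (Sum.inr (i, r, j)), by simp⟩ := by
    refine Finset.measurable_fun_sum _ fun r _ => ?_
    exact measurable_sum_range.comp
      ((Nat.measurable_floor.comp (measurable_pi_apply _)).prodMk
        (measurable_pi_iff.2 fun j => measurable_pi_apply _))
  have h2 := h1.comp hφ hψ
  convert! h2 using 1
  ext ω
  simp [commTime, systemVars]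

variable [IsProbabilityMeasure Pr]

/-- The completion times of different workers depend on disjoint sets of variables of the system. -/
theorem iIndepFun_completionTime (h : IsCodedSystem m k μ₁ μ₂ ε Pr X N Y) :
    iIndepFun (fun i ω => X i ω + commTime N Y i ω) Pr := by
  let worker : Fin n ⊕ (Fin n × Fin (m / k)) ⊕ (Fin n × Fin (m / k) × ℕ) → Fin n :=
    Sum.elim id (Sum.elim Prod.fst Prod.fst)
  have h1 : iIndepFun (fun i ω (x : {x // worker x = i}) => systemVars X N Y x ω) Pr :=
    iIndepFun.curry (fun i (x : {x // worker x = i}) => h.measurable_systemVars x)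
      (h.indep.precomp (Equiv.sigmaFiberEquiv worker).injective)
  have h2 := h1.comp (fun i f => f ⟨Sum.inl i, rfl⟩ +
    ∑ r : Fin (m / k), ∑ j ∈ Finset.range ⌊f ⟨Sum.inr (Sum.inl (i, r)), rfl⟩⌋₊,
      f ⟨Sum.inr (Sum.inr (i, r, j)), rfl⟩) fun i => by
    refine (measurable_pi_apply _).add (Finset.measurable_fun_sum _ fun r _ => ?_)
    exact measurable_sum_range.comp
      ((Nat.measurable_floor.comp (measurable_pi_apply _)).prodMk
        (measurable_pi_iff.2 fun j => measurable_pi_apply _))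
  convert! h2 using 1
  ext i ω
  simp [commTime, systemVars]

/-- If there is only one inner product to send, the communication time is exponential. -/
theorem map_commTime (h : IsCodedSystem m k μ₁ μ₂ ε Pr X N Y) (hmk : m / k = 1) (hμ₂ : 0 < μ₂)
    (hε₀ : 0 ≤ ε) (hε₁ : ε < 1) (i : Fin n) :
    Pr.map (commTime N Y i) = expMeasure ((1 - ε) * μ₂) := by
  have : Subsingleton (Fin (m / k)) := by rw [hmk]; infer_instance
  let r : Fin (m / k) := ⟨0, by omega⟩
  have hcomm : commTime N Y i = fun ω => ∑ j ∈ Finset.range (N i r ω), Y i r j ω := by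
    ext ω
    exact Fintype.sum_subsingleton _ r
  rw [hcomm]
  refine map_geometric_sum hμ₂ hε₀ hε₁ (h.measurable_N i r) (h.measurable_Y i r)
    (h.law_N i r) (h.law_Y i r) ?_ ?_
  · have h1 := iIndepFun.indepFun_of_disjoint h.measurable_systemVars h.indep
      (S := {Sum.inr (Sum.inl (i, r))}) (T := range fun j => Sum.inr (Sum.inr (i, r, j)))
      (by simp)
    have hφ : Measurable fun f : ({Sum.inr (Sum.inl (i, r))} : Set (Fin n ⊕
        (Fin n × Fin (m / k)) ⊕ (Fin n × Fin (m / k) × ℕ))) → ℝ =>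
        ⌊f ⟨Sum.inr (Sum.inl (i, r)), rfl⟩⌋₊ :=
      Nat.measurable_floor.comp (measurable_pi_apply _)
    have h2 := h1.comp (ψ := fun f j => f ⟨Sum.inr (Sum.inr (i, r, j)), j, rfl⟩) hφ
      (measurable_pi_iff.2 fun j => measurable_pi_apply _)
    convert! h2 using 1
    ext ω
    simp [systemVars]
  · exact h.indep.precomp (g := fun j => Sum.inr (Sum.inr (i, r, j)))
      fun j j' hj => by simpa using hj

theorem integrable_completionTime (h : IsCodedSystem m k μ₁ μ₂ ε Pr X N Y) (hmk : m / k = 1)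
    (hμ₁ : 0 < (k : ℝ) * μ₁ / m) (hμ₂ : 0 < μ₂) (hε₀ : 0 ≤ ε) (hε₁ : ε < 1) (i : Fin n) :
    Integrable (fun ω => X i ω + commTime N Y i ω) Pr := by
  have key : ∀ {Z : Ω → ℝ} {r : ℝ}, 0 < r → Measurable Z → Pr.map Z = expMeasure r →
      Integrable Z Pr := by
    intro Z r hr hZ hlaw
    have h1 := integrable_id_expMeasure hr
    rw [← hlaw] at h1
    exact h1.comp_measurable hZ
  exact (key hμ₁ (h.measurable_X i) (h.law_X i)).add
    (key (mul_pos (by linarith) hμ₂) (h.measurable_commTime i)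
      (h.map_commTime hmk hμ₂ hε₀ hε₁ i))

end IsCodedSystem

theorem measurable_kthMin {n : ℕ} {Ω : Type*} [MeasurableSpace Ω] {Z : Fin n → Ω → ℝ}
    (hZ : ∀ i, Measurable (Z i)) (k : ℕ) (hk : 1 ≤ k ∧ k ≤ n) :
    Measurable fun ω => kthMin (fun i => Z i ω) k hk := by
  refine measurable_of_Iic fun t => ?_
  have h1 : (fun ω => kthMin (fun i => Z i ω) k hk) ⁻¹' Iic t =
      {ω | k ≤ ∑ i, if Z i ω ≤ t then 1 else 0} := by
    ext ω
    rw [mem_preimage, mem_Iic, kthMin_le_iff, Finset.card_filter]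
    rfl
  rw [h1]
  refine measurableSet_le measurable_const (Finset.measurable_fun_sum _ fun i _ => ?_)
  exact Measurable.ite (measurableSet_le (hZ i) measurable_const) measurable_const measurable_const

theorem integrable_kthMin {n : ℕ} {Ω : Type*} [MeasurableSpace Ω] {Pr : Measure Ω}
    {Z : Fin n → Ω → ℝ} (hZ : ∀ i, Measurable (Z i)) (hint : ∀ i, Integrable (Z i) Pr) (k : ℕ)
    (hk : 1 ≤ k ∧ k ≤ n) : Integrable (fun ω => kthMin (fun i => Z i ω) k hk) Pr := by
  refine Integrable.mono' (integrable_finsetSum Finset.univ fun i _ => (hint i).abs)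
    (measurable_kthMin hZ k hk).aestronglyMeasurable (Eventually.of_forall fun ω => ?_)
  exact abs_kthMin_le _ k hk

theorem theorem1 (n m k : ℕ) (hk : 1 ≤ k ∧ k ≤ n) (hkm : k = m)
    (μ₁ μ₂ ε : ℝ) (hμ₁ : 0 < μ₁) (hμ₂ : 0 < μ₂) (hε₀ : 0 ≤ ε) (hε₁ : ε < 1)
    -- the Markov chain, started at `(0, 0)`
    {Ω : Type*} [MeasurableSpace Ω] (Pr : Measure Ω) [IsProbabilityMeasure Pr]
    (C : ℝ≥0 → Ω → Fin (n + 1) × Fin (k + 1))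
    (hC : IsMarkovChainFrom (codedRate n k μ₁ μ₂ ε) (0, 0) C Pr)
    -- the coded computation
    {Ω' : Type*} [MeasurableSpace Ω'] (Pr' : Measure Ω') [IsProbabilityMeasure Pr']
    (X : Fin n → Ω' → ℝ) (N : Fin n → Fin (m / k) → Ω' → ℕ)
    (Y : Fin n → Fin (m / k) → ℕ → Ω' → ℝ)
    (hXNY : IsCodedSystem m k μ₁ μ₂ ε Pr' X N Y) :
    Integrable (runTime X N Y k hk) Pr' ∧
      ∫⁻ ω, hittingTime C {x | x.2 = Fin.last k} ω ∂Pr =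
        ENNReal.ofReal (∫ ω, runTime X N Y k hk ω ∂Pr') := by
  have hk0 : (k : ℝ) ≠ 0 := by
    have := hk.1
    positivity
  have hmk : m / k = 1 := by rw [← hkm]; exact Nat.div_self hk.1
  have hrate : (k : ℝ) * μ₁ / m = μ₁ := by
    rw [← hkm]
    field_simp
  have hν : 0 < (1 - ε) * μ₂ := mul_pos (by linarith) hμ₂
  set Z : Fin n → Ω' → ℝ := fun i ω => X i ω + commTime N Y i ω
  have hZ : ∀ i, Measurable (Z i) := hXNY.measurable_completionTime
  have hint : Integrable (runTime X N Y k hk) Pr' :=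
    integrable_kthMin hZ (fun i => hXNY.integrable_completionTime hmk (by rw [hrate]; exact hμ₁)
      hμ₂ hε₀ hε₁ i) k hk
  have hT : Measurable (runTime X N Y k hk) := measurable_kthMin hZ k hk
  have hlaw : ∀ t : ℝ, 0 ≤ t → Pr'.real {ω | runTime X N Y k hk ω ≤ t} =
      1 - ∑ v ∈ Finset.range k, n.choose v *
        sumCdf μ₁ ((1 - ε) * μ₂) t ^ v * (1 - sumCdf μ₁ ((1 - ε) * μ₂) t) ^ (n - v) := by
    intro t ht
    rw [← measure_le_card_filter hZ hXNY.iIndepFun_completionTime (fun i =>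
      measureReal_add_le hμ₁ hν (hXNY.measurable_X i) (hXNY.measurable_commTime i)
        (by rw [hXNY.law_X i, hrate]) (hXNY.map_commTime hmk hμ₂ hε₀ hε₁ i)
        (hXNY.indepFun_commTime i) ht) k]
    congr 1
    ext ω
    exact kthMin_le_iff _ k hk t
  -- at time `0` the distribution function vanishes, so the run-time is positive almost surely
  have hpos : 0 ≤ᵐ[Pr'] runTime X N Y k hk := by
    have h0 : Pr'.real {ω | runTime X N Y k hk ω ≤ 0} = 0 := by
      rw [hlaw 0 le_rfl, sumCdf_zero, Finset.sum_eq_single_of_mem 0 (Finset.mem_range.2 hk.1)]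
      · simp
      · intro v _ hv
        simp [hv]
    rw [measureReal_eq_zero_iff] at h0
    refine measure_mono_null (fun ω hω => ?_) h0
    have hω' : ¬0 ≤ runTime X N Y k hk ω := hω
    exact (not_le.1 hω').le
  refine ⟨hint, ?_⟩
  have hτ : Measurable (hittingTime C {x | x.2 = Fin.last k}) := hC.measurable_hittingTime _
  -- the hitting time and the run-time have the same law
  have hmap : Pr.map (hittingTime C {x | x.2 = Fin.last k}) =
      Pr'.map fun ω => ENNReal.ofReal (runTime X N Y k hk ω) := by
    have := Measure.isProbabilityMeasure_map hτ.aemeasurable (μ := Pr)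
    refine Measure.ext_of_Iic _ _ fun a => ?_
    rw [Measure.map_apply hτ measurableSet_Iic,
      Measure.map_apply hT.ennreal_ofReal measurableSet_Iic]
    induction a with
    | top => simp
    | coe t =>
      have h1 : (fun ω => ENNReal.ofReal (runTime X N Y k hk ω)) ⁻¹' Iic (t : ℝ≥0∞) =
          {ω | runTime X N Y k hk ω ≤ t} := by
        ext ω
        simp only [mem_preimage, mem_Iic, mem_ofPred_eq]
        rw [← ENNReal.ofReal_coe_nnreal, ENNReal.ofReal_le_ofReal_iff t.coe_nonneg]
      rw [h1, ← ofReal_measureReal (μ := Pr'), hlaw t t.coe_nonneg]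
      exact measure_hittingTime_coded_le hC t
  rw [ofReal_integral_eq_lintegral_ofReal hint hpos]
  have h1 := lintegral_map (μ := Pr) measurable_id hτ
  have h2 := lintegral_map (μ := Pr') measurable_id hT.ennreal_ofReal
  rw [hmap, h2] at h1
  exact h1.symm
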